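/- Consider a finite-horizon robust MDP with nonempty finite state space $S$, nonempty finite action space $A$, horizon $H$, known deterministic rewards $r_h:S\times A\to[0,1]$ and unknown nominal transition kernels $P^o_{h,s,a}\in\Delta(S)$, $h\in\{1,\dots,H\}$. For $\rho>0$ and $Q\in\Delta(S)$ let $B_\rho(Q)=\{P\in\Delta(S):\sum_{s'}(P(s')-Q(s'))^2/Q(s')\le\rho\}$ (with $0/0=0$ and $x/0=\infty$ for $x>0$), and let the uncertainty set be $\mathcal P=\prod_{h,s,a}B_\rho(P^o_{h,s,a})$. For a deterministic Markov policy $\pi=(\pi_h)_{h=1}^H$ let $V_h^{\pi}(s)=\inf_{P\in\mathcal P}\mathbb E_{\pi,P}\big[\sum_{t=h}^H r_t(s_t,a_t)\mid s_h=s\big]$, and let $V^*_h(s)=\sup_\pi V^\pi_h(s)$, the supremum being over all deterministic Markov policies. The Robust Phased Value Learning (RPVL) algorithm draws, for every $(h,s,a)$, $N$ next-state samples from $P^o_{h,s,a}$, all samples being independent, so that $N_{\mathrm{total}}=N|S||A|H$ samples are used. It forms the empirical distributions $\widehat P^o_{h,s,a}$, sets $\widehat V_{H+1}=0$, and for $h=H,\dots,1$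 computes $$\widehat V_h(s)=\max_{a}\Big(r_h(s,a)+\inf_{P\in B_\rho(\widehat P^o_{h,s,a})}\sum_{s'}P(s')\widehat V_{h+1}(s')\Big),$$ and returns $\hat\pi=(\hat\pi_h)_{h=1}^H$, where $\hat\pi_h(s)$ is an action attaining this maximum. Theorem. Let $\delta\in(0,1)$, $\rho>0$, $\epsilon\in(0,8H)$, $C_\rho=\sqrt{1+\rho}$, and suppose $$N_{\mathrm{total}}\ \ge\ \frac{128\,C_\rho^4H^5|S||A|}{(C_\rho-1)^2\epsilon^2}\cdot\log\frac{2H|S||A|\Big(1+\frac{8C_\rho H^2}{\epsilon(C_\rho-1)}\Big)}{\delta}.$$ Then, with probability at least $1-\delta$, $\max_{1\le h\le H}\max_{s\in S}|V^*_h(s)-V^{\hat\pi}_h(s)|\le\epsilon$, however ties in the maxima are broken. -/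

import Mathlib

open MeasureTheory ProbabilityTheory
open scoped ENNReal

namespace RobustMDP

noncomputable section

/-- The expectation `P V` of the real vector `V` under the probability vector `P`. -/
def expect {S : Type*} [Fintype S] (P V : S → ℝ) : ℝ := ∑ s, P s * V s

/-- The chi-square distance `∑ (P s - Q s)² / Q s` of two probability vectors, with the usual
conventions `0 / 0 = 0` and `x / 0 = ∞` for `x > 0` (it is an `f`-divergence: a finite distance
forces `P` to vanish wherever `Q` does). -/
def chiSqDist {S : Type*} [Fintype S] (P Q : S → ℝ) : ℝ≥0∞ :=
  ∑ s, ENNReal.ofReal ((P s - Q s) ^ 2) / ENNReal.ofReal (Q s)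

/-- The ball of radius `ρ` around `Q` in the probability simplex, for the chi-square distance. -/
def chiSqBall {S : Type*} [Fintype S] (ρ : ℝ) (Q : S → ℝ) : Set (S → ℝ) :=
  {P | P ∈ stdSimplex ℝ S ∧ chiSqDist P Q ≤ ENNReal.ofReal ρ}

/-- `worst U V = inf {P V : P ∈ U}`. -/
def worst {S : Type*} [Fintype S] (U : Set (S → ℝ)) (V : S → ℝ) : ℝ :=
  sInf ((fun P => expect P V) '' U)

/-- The (rectangular) uncertainty set: all models `P` such that every `P h s a` lies in the
chi-square ball of radius `ρ` around the nominal `P₀ h s a`. -/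
def uncertaintySet {S A : Type*} [Fintype S] {H : ℕ} (ρ : ℝ) (P₀ : Fin H → S → A → S → ℝ) :
    Set (Fin H → S → A → S → ℝ) :=
  {P | ∀ h s a, P h s a ∈ chiSqBall ρ (P₀ h s a)}

/-- Probability of the state trajectory `x 0, x 1, …` at the times `h, h + 1, …, H`, given its
first state, when the deterministic Markov policy `π` is followed in the model `P`.
Times are numbered from `0`: decisions are taken at the times `0, …, H - 1`. -/
def trajProb {S A : Type*} {H : ℕ} (P : Fin H → S → A → S → ℝ) (π : Fin H → S → A) (h : Fin H)
    (x : Fin (H - h + 1) → S) : ℝ :=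
  ∏ k : Fin (H - h),
    P ⟨h + k, by omega⟩ (x k.castSucc) (π ⟨h + k, by omega⟩ (x k.castSucc)) (x k.succ)

/-- Total reward collected along a trajectory from time `h` on. -/
def trajReward {S A : Type*} {H : ℕ} (r : Fin H → S → A → ℝ) (π : Fin H → S → A) (h : Fin H)
    (x : Fin (H - h + 1) → S) : ℝ :=
  ∑ k : Fin (H - h), r ⟨h + k, by omega⟩ (x k.castSucc) (π ⟨h + k, by omega⟩ (x k.castSucc))

/-- The value of the policy `π` in the model `P`: the expected total reward from time `h` on,
given that the state at time `h` is `s`. -/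
def value {S A : Type*} [Fintype S] {H : ℕ} (r : Fin H → S → A → ℝ) (P : Fin H → S → A → S → ℝ)
    (π : Fin H → S → A) (h : Fin H) (s : S) : ℝ :=
  ∑ y : Fin (H - h) → S,
    trajProb P π h (Fin.cons s y : Fin (H - h + 1) → S) *
      trajReward r π h (Fin.cons s y : Fin (H - h + 1) → S)

/-- The robust value of the policy `π`: the infimum of its values over the uncertainty set. -/
def robustValue {S A : Type*} [Fintype S] {H : ℕ} (r : Fin H → S → A → ℝ) (ρ : ℝ)
    (P₀ : Fin H → S → A → S → ℝ) (π : Fin H → S → A) (h : Fin H) (s : S) : ℝ :=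
  ⨅ P : uncertaintySet ρ P₀, value r P.1 π h s

/-- The optimal robust value: the supremum over the deterministic Markov policies. -/
def optRobustValue {S A : Type*} [Fintype S] {H : ℕ} (r : Fin H → S → A → ℝ) (ρ : ℝ)
    (P₀ : Fin H → S → A → S → ℝ) (h : Fin H) (s : S) : ℝ :=
  ⨆ π : Fin H → S → A, robustValue r ρ P₀ π h s

/-- The maximum likelihood estimate from `N` samples per `(h, s, a)`: the empirical frequencies
of the next states. -/
def empirical {S A : Type*} [DecidableEq S] {H N : ℕ} (x : Fin H → S → A → Fin N → S) :
    Fin H → S → A → S → ℝ :=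
  fun h s a s' => ((Finset.univ.filter fun i => x h s a i = s').card : ℝ) / N

/-- `r h s a + inf {P V : P ∈ ball around Q h s a}`. -/
def robustQ {S A : Type*} [Fintype S] {H : ℕ} (r : Fin H → S → A → ℝ) (ρ : ℝ)
    (Q : Fin H → S → A → S → ℝ) (V : S → ℝ) (h : Fin H) (s : S) (a : A) : ℝ :=
  r h s a + worst (chiSqBall ρ (Q h s a)) V

/-- The value functions computed by robust dynamic programming around the estimate `Q`:
`0` at the final time `H`, and backwards `V h s = max_a (r h s a + inf {P V(h+1)})`. -/
def rpvlValue {S A : Type*} [Fintype S] {H : ℕ} (r : Fin H → S → A → ℝ) (ρ : ℝ)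
    (Q : Fin H → S → A → S → ℝ) : Fin (H + 1) → S → ℝ :=
  Fin.reverseInduction (motive := fun _ => S → ℝ) (fun _ => 0)
    (fun h V s => ⨆ a : A, robustQ r ρ Q V h s a)

/-- `π` is an output of the Robust Phased Value Learning algorithm run with radius `ρ` on the
sampled next states `x`: at every time and state it picks an action that attains the maximum
(ties may be broken in any way). -/
def IsRPVLOutput {S A : Type*} [Fintype S] [DecidableEq S] {H N : ℕ} (r : Fin H → S → A → ℝ)
    (ρ : ℝ) (x : Fin H → S → A → Fin N → S) (π : Fin H → S → A) : Prop :=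
  ∀ h s a, robustQ r ρ (empirical x) (rpvlValue r ρ (empirical x) h.succ) h s a ≤
    robustQ r ρ (empirical x) (rpvlValue r ρ (empirical x) h.succ) h s (π h s)

/-- `X h s a i` (`i < N`) are the samples of a generative model with transition probabilities
`P₀`: all of them are independent, and `X h s a i` has the law `P₀ h s a`. -/
structure IsGenerativeSample {S A Ω : Type*} [MeasurableSpace S] [MeasurableSpace Ω] {H N : ℕ}
    (μ : Measure Ω) (P₀ : Fin H → S → A → S → ℝ) (X : Fin H → S → A → Fin N → Ω → S) : Prop where
  measurable : ∀ h s a i, Measurable (X h s a i)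
  indep : iIndepFun (fun j : Fin H × S × A × Fin N => X j.1 j.2.1 j.2.2.1 j.2.2.2) μ
  law : ∀ h s a i s', μ.real {ω | X h s a i ω = s'} = P₀ h s a s'

end

end RobustMDP

/-!
The chi-square ball around `Q` is cut out of the simplex by a single quadratic constraint, and
Lagrangian duality turns the worst case of `V` over it into the maximum over `η` of
`η - √(1 + ρ) * √(E_Q (η - V)₊²)`: the law `Q` enters only through one square root moment.
For means of independent variables with values in `[0, 1]` the square root stabilises the variance,
so that a Chernoff bound gives a deviation inequality whose constants do not involve `Q`. Since the
dual is Lipschitz in `η` and its maximiser is bounded, a union bound over a grid of levels `η`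
suffices. The value function of stage `h + 1` is computed from samples independent of those of
stage `h`, hence can be treated as fixed there, and the errors of the stages add up along the
backward induction.
-/

namespace RobustMDP

noncomputable section

section ChiSquareDuality

variable {S : Type*} [Fintype S] {ρ b : ℝ} {P Q V W : S → ℝ}

lemma expect_mono (hP : P ∈ stdSimplex ℝ S) (h : ∀ s, V s ≤ W s) : expect P V ≤ expect P W :=
  Finset.sum_le_sum fun s _ => mul_le_mul_of_nonneg_left (h s) (hP.1 s)

lemma expect_const (hP : P ∈ stdSimplex ℝ S) (c : ℝ) : expect P (fun _ => c) = c := by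
  rw [expect, ← Finset.sum_mul, hP.2, one_mul]

lemma expect_add_const (hP : P ∈ stdSimplex ℝ S) (V : S → ℝ) (c : ℝ) :
    expect P (fun s => V s + c) = expect P V + c := by
  simp_rw [expect, mul_add, Finset.sum_add_distrib, ← Finset.sum_mul, hP.2, one_mul]

lemma expect_const_sub (hP : P ∈ stdSimplex ℝ S) (c : ℝ) (V : S → ℝ) :
    expect P (fun s => c - V s) = c - expect P V := by
  simp_rw [expect, mul_sub, Finset.sum_sub_distrib, ← Finset.sum_mul, hP.2, one_mul]

lemma expect_mem_Icc {a : ℝ} (hP : P ∈ stdSimplex ℝ S) (hV : ∀ s, V s ∈ Set.Icc a b) :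
    expect P V ∈ Set.Icc a b :=
  ⟨(expect_const hP a).ge.trans (expect_mono hP fun s => (hV s).1),
    (expect_mono hP fun s => (hV s).2).trans (expect_const hP b).le⟩

lemma exists_pos_of_mem_stdSimplex (hQ : Q ∈ stdSimplex ℝ S) : ∃ s, 0 < Q s := by
  obtain ⟨s, -, hs⟩ := Finset.exists_lt_of_sum_lt (s := Finset.univ) (f := 0) (g := Q)
    (by simp [hQ.2])
  exact ⟨s, hs⟩

lemma chiSqDist_eq_ofReal (hP : P ∈ stdSimplex ℝ S) (hQ : Q ∈ stdSimplex ℝ S)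
    (h : ∀ s, Q s = 0 → P s = 0) :
    chiSqDist P Q = ENNReal.ofReal (∑ s, P s ^ 2 / Q s - 1) := by
  have expand : ∀ s, (P s - Q s) ^ 2 / Q s = P s ^ 2 / Q s - 2 * P s + Q s := by
    intro s
    by_cases hs : Q s = 0
    · simp [hs, h s hs]
    · field_simp
      ring
  have hsum : ∑ s, P s ^ 2 / Q s - 1 = ∑ s, (P s - Q s) ^ 2 / Q s := by
    simp_rw [expand, Finset.sum_add_distrib, Finset.sum_sub_distrib, ← Finset.mul_sum]
    rw [hP.2, hQ.2]
    ring
  rw [hsum, ENNReal.ofReal_sum_of_nonneg fun s _ => div_nonneg (sq_nonneg _) (hQ.1 s)]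
  refine Finset.sum_congr rfl fun s _ => ?_
  rcases (hQ.1 s).eq_or_lt with hs | hs
  · simp [← hs, h s hs.symm]
  · rw [ENNReal.ofReal_div_of_pos hs]

lemma eq_zero_of_chiSqDist_ne_top (h : chiSqDist P Q ≠ ⊤) {s : S} (hs : Q s = 0) : P s = 0 := by
  by_contra hne
  refine h (ENNReal.sum_eq_top.2 ⟨s, Finset.mem_univ s, ?_⟩)
  rw [hs, sub_zero, ENNReal.ofReal_zero, ENNReal.div_zero]
  exact (ENNReal.ofReal_pos.2 (by positivity)).ne'

lemma mem_chiSqBall_iff (hρ : 0 ≤ ρ) (hQ : Q ∈ stdSimplex ℝ S) :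
    P ∈ chiSqBall ρ Q ↔ P ∈ stdSimplex ℝ S ∧ (∀ s, Q s = 0 → P s = 0) ∧
      ∑ s, P s ^ 2 / Q s ≤ 1 + ρ := by
  refine and_congr_right fun hP => ⟨fun h => ?_, ?_⟩
  · have h0 : ∀ s, Q s = 0 → P s = 0 := fun s =>
      eq_zero_of_chiSqDist_ne_top (ne_top_of_le_ne_top ENNReal.ofReal_ne_top h)
    rw [chiSqDist_eq_ofReal hP hQ h0, ENNReal.ofReal_le_ofReal_iff hρ] at h
    exact ⟨h0, by linarith⟩
  · rintro ⟨h0, h⟩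
    rw [chiSqDist_eq_ofReal hP hQ h0]
    exact ENNReal.ofReal_le_ofReal (by linarith)

lemma chiSqBall_subset_stdSimplex : chiSqBall ρ Q ⊆ stdSimplex ℝ S := fun _ hP => hP.1

lemma self_mem_chiSqBall (hQ : Q ∈ stdSimplex ℝ S) : Q ∈ chiSqBall ρ Q :=
  ⟨hQ, by simp [chiSqDist]⟩

lemma isCompact_chiSqBall (hρ : 0 ≤ ρ) (hQ : Q ∈ stdSimplex ℝ S) : IsCompact (chiSqBall ρ Q) := by
  refine (isCompact_stdSimplex ℝ S).of_isClosed_subset ?_ chiSqBall_subset_stdSimplex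
  have hball : chiSqBall ρ Q = stdSimplex ℝ S ∩
      ((⋂ s, {P | Q s = 0 → P s = 0}) ∩ {P | ∑ s, P s ^ 2 / Q s ≤ 1 + ρ}) := by
    ext P
    simp [mem_chiSqBall_iff hρ hQ]
  rw [hball]
  refine (isClosed_stdSimplex ℝ S).inter (.inter (isClosed_iInter fun s => ?_) ?_)
  · by_cases hs : Q s = 0
    · simpa [hs] using isClosed_eq (continuous_apply s) continuous_const
    · simp [hs]
  · exact isClosed_le (by fun_prop) continuous_const

lemma bddBelow_expect_image {U : Set (S → ℝ)} (hU : U ⊆ stdSimplex ℝ S) (V : S → ℝ) :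
    BddBelow ((fun P => expect P V) '' U) := by
  obtain ⟨c, hc⟩ := (Set.finite_range V).bddBelow
  refine ⟨c, ?_⟩
  rintro _ ⟨P, hP, rfl⟩
  exact (expect_const (hU hP) c).ge.trans (expect_mono (hU hP) fun s => hc ⟨s, rfl⟩)

lemma worst_le_expect {U : Set (S → ℝ)} (hU : U ⊆ stdSimplex ℝ S) (hP : P ∈ U) (V : S → ℝ) :
    worst U V ≤ expect P V :=
  csInf_le (bddBelow_expect_image hU V) ⟨P, hP, rfl⟩

lemma le_worst {U : Set (S → ℝ)} (hU : U.Nonempty) {c : ℝ} (h : ∀ P ∈ U, c ≤ expect P V) :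
    c ≤ worst U V :=
  le_csInf (hU.image _) (Set.forall_mem_image.2 h)

lemma worst_mem_Icc {U : Set (S → ℝ)} (hU : U ⊆ stdSimplex ℝ S) (hne : U.Nonempty) {a : ℝ}
    (hV : ∀ s, V s ∈ Set.Icc a b) : worst U V ∈ Set.Icc a b := by
  refine ⟨le_worst hne fun P hP => (expect_mem_Icc (hU hP) hV).1, ?_⟩
  obtain ⟨P, hP⟩ := hne
  exact (worst_le_expect hU hP V).trans (expect_mem_Icc (hU hP) hV).2

lemma exists_expect_eq_worst (hρ : 0 ≤ ρ) (hQ : Q ∈ stdSimplex ℝ S) (V : S → ℝ) :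
    ∃ P ∈ chiSqBall ρ Q, expect P V = worst (chiSqBall ρ Q) V := by
  have hcont : Continuous fun P : S → ℝ => expect P V := by
    unfold expect
    fun_prop
  obtain ⟨P, hP, hPV⟩ := (isCompact_chiSqBall hρ hQ).exists_sInf_image_eq
    ⟨Q, self_mem_chiSqBall hQ⟩ hcont.continuousOn
  exact ⟨P, hP, hPV.symm⟩

lemma expect_le_sqrt_mul_sqrt_expect_sq (hρ : 0 ≤ ρ) (hQ : Q ∈ stdSimplex ℝ S)
    (hP : P ∈ chiSqBall ρ Q) (f : S → ℝ) :
    expect P f ≤ √(1 + ρ) * √(expect Q fun s => f s ^ 2) := by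
  obtain ⟨-, h0, hle⟩ := (mem_chiSqBall_iff hρ hQ).1 hP
  have hf : ∀ s, 0 ≤ Q s * f s ^ 2 := fun s => mul_nonneg (hQ.1 s) (sq_nonneg _)
  have cauchySchwarz :
      expect P f ^ 2 ≤ (∑ s, P s ^ 2 / Q s) * expect Q fun s => f s ^ 2 := by
    refine Finset.sum_sq_le_sum_mul_sum_of_sq_le_mul _
      (fun s _ => div_nonneg (sq_nonneg _) (hQ.1 s)) (fun s _ => hf s) fun s _ => le_of_eq ?_
    by_cases hs : Q s = 0
    · simp [hs, h0 s hs]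
    · field_simp
  rw [← Real.sqrt_mul (by linarith)]
  exact Real.le_sqrt_of_sq_le (cauchySchwarz.trans
    (mul_le_mul_of_nonneg_right hle (Finset.sum_nonneg fun s _ => hf s)))

/-- The mean shortfall `E_Q (η - V)₊` of `V` below the level `η`: half the derivative in `η` of
the second moment `shortfallSq`, it governs the stationarity of the dual objective. -/
def meanShortfall (Q V : S → ℝ) (η : ℝ) : ℝ := expect Q fun s => max (η - V s) 0

/-- The second moment `E_Q (η - V)₊²` of the shortfall of `V` below the level `η`. -/
def shortfallSq (Q V : S → ℝ) (η : ℝ) : ℝ := expect Q fun s => max (η - V s) 0 ^ 2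

/-- The objective `η - √(1 + ρ) √(E_Q (η - V)₊²)` of the one-dimensional concave maximization that
is dual to minimizing `P V` over the chi-square ball of radius `ρ` around `Q`. -/
def dualObj (ρ : ℝ) (Q V : S → ℝ) (η : ℝ) : ℝ := η - √(1 + ρ) * √(shortfallSq Q V η)

lemma shortfallSq_nonneg (hQ : Q ∈ stdSimplex ℝ S) (V : S → ℝ) (η : ℝ) : 0 ≤ shortfallSq Q V η :=
  Finset.sum_nonneg fun s _ => mul_nonneg (hQ.1 s) (sq_nonneg _)

lemma shortfallSq_mono (hQ : Q ∈ stdSimplex ℝ S) (V : S → ℝ) : Monotone (shortfallSq Q V) :=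
  fun _ _ h => expect_mono hQ fun s => by gcongr

lemma meanShortfall_pos (hQ : Q ∈ stdSimplex ℝ S) {s : S} (hs : 0 < Q s) {η : ℝ} (hη : V s < η) :
    0 < meanShortfall Q V η :=
  Finset.sum_pos' (fun s _ => mul_nonneg (hQ.1 s) (le_max_right _ _))
    ⟨s, Finset.mem_univ s, mul_pos hs (lt_max_of_lt_left (sub_pos.2 hη))⟩

lemma dualObj_le_worst (hρ : 0 ≤ ρ) (hQ : Q ∈ stdSimplex ℝ S) (V : S → ℝ) (η : ℝ) :
    dualObj ρ Q V η ≤ worst (chiSqBall ρ Q) V := by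
  refine le_worst ⟨Q, self_mem_chiSqBall hQ⟩ fun P hP => ?_
  have h : η - expect P V ≤ √(1 + ρ) * √(shortfallSq Q V η) :=
    calc η - expect P V = expect P fun s => η - V s := (expect_const_sub hP.1 η V).symm
      _ ≤ expect P fun s => max (η - V s) 0 := expect_mono hP.1 fun s => le_max_left _ _
      _ ≤ _ := expect_le_sqrt_mul_sqrt_expect_sq hρ hQ hP _
  unfold dualObj
  linarith

/-- The probability vector proportional to `Q (η - V)₊`, which is where the Cauchy-Schwarz
inequality behind weak duality is an equality. -/
def shortfallTilt (Q V : S → ℝ) (η : ℝ) (s : S) : ℝ :=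
  Q s * max (η - V s) 0 / meanShortfall Q V η

lemma shortfallTilt_mem_chiSqBall (hρ : 0 ≤ ρ) (hQ : Q ∈ stdSimplex ℝ S) {η : ℝ}
    (hpos : 0 < meanShortfall Q V η)
    (h : √(shortfallSq Q V η) ≤ √(1 + ρ) * meanShortfall Q V η) :
    shortfallTilt Q V η ∈ chiSqBall ρ Q := by
  refine (mem_chiSqBall_iff hρ hQ).2
    ⟨⟨fun s => ?_, ?_⟩, fun s hs => by simp [shortfallTilt, hs], ?_⟩
  · exact div_nonneg (mul_nonneg (hQ.1 s) (le_max_right _ _)) hpos.le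
  · simp_rw [shortfallTilt, ← Finset.sum_div]
    exact div_self hpos.ne'
  · have hterm : ∀ s, shortfallTilt Q V η s ^ 2 / Q s =
        Q s * max (η - V s) 0 ^ 2 / meanShortfall Q V η ^ 2 := by
      intro s
      rw [shortfallTilt]
      by_cases hs : Q s = 0
      · simp [hs]
      · field_simp
    simp_rw [hterm, ← Finset.sum_div]
    rw [div_le_iff₀ (by positivity)]
    calc shortfallSq Q V η ≤ (√(1 + ρ) * meanShortfall Q V η) ^ 2 :=
          (Real.sqrt_le_left (by positivity)).1 h
      _ = (1 + ρ) * meanShortfall Q V η ^ 2 := by rw [mul_pow, Real.sq_sqrt (by linarith)]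

lemma expect_shortfallTilt {η : ℝ} (hpos : 0 < meanShortfall Q V η) :
    expect (shortfallTilt Q V η) V = η - shortfallSq Q V η / meanShortfall Q V η := by
  have hterm : ∀ s, shortfallTilt Q V η s * V s =
      η / meanShortfall Q V η * (Q s * max (η - V s) 0) -
        Q s * max (η - V s) 0 ^ 2 / meanShortfall Q V η := by
    intro s
    rw [shortfallTilt]
    rcases le_total (η - V s) 0 with hs | hs
    · simp [max_eq_right hs]
    · rw [max_eq_left hs]
      ring
  simp_rw [expect, hterm, Finset.sum_sub_distrib, ← Finset.mul_sum, ← Finset.sum_div]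
  change η / meanShortfall Q V η * meanShortfall Q V η - _ = _
  rw [div_mul_cancel₀ _ hpos.ne']
  rfl

lemma worst_le_of_sqrt_shortfallSq_le (hρ : 0 ≤ ρ) (hQ : Q ∈ stdSimplex ℝ S) {η : ℝ}
    (hpos : 0 < meanShortfall Q V η)
    (h : √(shortfallSq Q V η) ≤ √(1 + ρ) * meanShortfall Q V η) :
    worst (chiSqBall ρ Q) V ≤ η - shortfallSq Q V η / meanShortfall Q V η :=
  (worst_le_expect chiSqBall_subset_stdSimplex (shortfallTilt_mem_chiSqBall hρ hQ hpos h) V).trans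
    (expect_shortfallTilt hpos).le

lemma worst_le_dualObj_of_sqrt_shortfallSq_eq (hρ : 0 ≤ ρ) (hQ : Q ∈ stdSimplex ℝ S) {η : ℝ}
    (hpos : 0 < meanShortfall Q V η)
    (h : √(shortfallSq Q V η) = √(1 + ρ) * meanShortfall Q V η) :
    worst (chiSqBall ρ Q) V ≤ dualObj ρ Q V η := by
  refine (worst_le_of_sqrt_shortfallSq_le hρ hQ hpos h.le).trans_eq ?_
  rw [dualObj, ← Real.mul_self_sqrt (shortfallSq_nonneg hQ V η), mul_div_assoc, mul_comm]
  nth_rw 1 [h]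
  rw [mul_div_cancel_right₀ _ hpos.ne', Real.sqrt_mul_self (Real.sqrt_nonneg _)]

lemma sqrt_shortfallSq_le_of_le (hρ : 0 < ρ) (hb : 0 ≤ b) (hQ : Q ∈ stdSimplex ℝ S)
    (hV : ∀ s, V s ∈ Set.Icc 0 b) {η : ℝ} (hη : √(1 + ρ) * b / (√(1 + ρ) - 1) ≤ η) :
    √(shortfallSq Q V η) ≤ √(1 + ρ) * meanShortfall Q V η := by
  have hC : 1 < √(1 + ρ) := Real.lt_sqrt_of_sq_lt (by linarith)
  have hη0 : 0 ≤ η := (div_nonneg (by positivity) (by linarith)).trans hη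
  have hsq : √(shortfallSq Q V η) ≤ η := by
    refine Real.sqrt_le_iff.2 ⟨hη0, ?_⟩
    refine (expect_mono hQ fun s => ?_).trans (expect_const hQ (η ^ 2)).le
    exact pow_le_pow_left₀ (le_max_right _ _) (max_le (by linarith [(hV s).1]) hη0) 2
  have hmean : η - b ≤ meanShortfall Q V η :=
    (expect_const hQ (η - b)).ge.trans
      (expect_mono hQ fun s => le_max_of_le_left (by linarith [(hV s).2]))
  rw [div_le_iff₀ (by linarith)] at hη
  calc √(shortfallSq Q V η) ≤ √(1 + ρ) * (η - b) := by linarith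
    _ ≤ √(1 + ρ) * meanShortfall Q V η := mul_le_mul_of_nonneg_left hmean (by linarith)

lemma exists_worst_le_dualObj (hρ : 0 < ρ) (hb : 0 ≤ b) (hQ : Q ∈ stdSimplex ℝ S)
    (hV : ∀ s, V s ∈ Set.Icc 0 b) :
    ∃ η ∈ Set.Icc 0 (√(1 + ρ) * b / (√(1 + ρ) - 1)),
      worst (chiSqBall ρ Q) V ≤ dualObj ρ Q V η := by
  have hC : 1 < √(1 + ρ) := Real.lt_sqrt_of_sq_lt (by linarith)
  obtain ⟨s₀, hs₀, hmin⟩ : ∃ s₀, 0 < Q s₀ ∧ ∀ s, 0 < Q s → V s₀ ≤ V s :=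
    Set.exists_min_image {s | 0 < Q s} V (Set.toFinite _) (exists_pos_of_mem_stdSimplex hQ)
  have hpos : ∀ η, V s₀ < η → 0 < meanShortfall Q V η := fun η => meanShortfall_pos hQ hs₀
  by_cases hneg : ∃ η, V s₀ < η ∧ √(1 + ρ) * meanShortfall Q V η < √(shortfallSq Q V η)
  · obtain ⟨η₁, hη₁, hlt⟩ := hneg
    have hle : η₁ ≤ √(1 + ρ) * b / (√(1 + ρ) - 1) := by
      by_contra! hgt
      exact hlt.not_ge (sqrt_shortfallSq_le_of_le hρ hb hQ hV hgt.le)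
    obtain ⟨η, hη, hstat⟩ : ∃ η ∈ Set.Icc η₁ (√(1 + ρ) * b / (√(1 + ρ) - 1)),
        √(1 + ρ) * meanShortfall Q V η = √(shortfallSq Q V η) :=
      isPreconnected_Icc.intermediate_value₂ (Set.left_mem_Icc.2 hle) (Set.right_mem_Icc.2 hle)
        (by unfold meanShortfall expect; fun_prop) (by unfold shortfallSq expect; fun_prop)
        hlt.le (sqrt_shortfallSq_le_of_le hρ hb hQ hV le_rfl)
    exact ⟨η, ⟨by linarith [(hV s₀).1, hη.1], hη.2⟩,
      worst_le_dualObj_of_sqrt_shortfallSq_eq hρ.le hQ (hpos η (hη₁.trans_le hη.1)) hstat.symm⟩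
  · -- The dual optimum is then the minimum `V s₀` of `V` on the support of `Q`, and the tilts at
    -- levels `η` decreasing to `V s₀` are admissible and have expectations at most `η`.
    push Not at hneg
    have hzero : shortfallSq Q V (V s₀) = 0 := by
      refine Finset.sum_eq_zero fun s _ => ?_
      rcases (hQ.1 s).eq_or_lt with hs | hs
      · simp [← hs]
      · simp [max_eq_right (sub_nonpos.2 (hmin s hs))]
    refine ⟨V s₀, ⟨(hV s₀).1, (hV s₀).2.trans ?_⟩, ?_⟩
    · rw [le_div_iff₀ (by linarith)]
      nlinarith
    · rw [dualObj, hzero, Real.sqrt_zero, mul_zero, sub_zero]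
      refine le_of_forall_gt_imp_ge_of_dense fun η hη =>
        (worst_le_of_sqrt_shortfallSq_le hρ.le hQ (hpos η hη) (hneg η hη)).trans ?_
      exact sub_le_self _ (div_nonneg (shortfallSq_nonneg hQ V η) (hpos η hη).le)

lemma worst_chiSqBall_le_add {θ τ : ℝ} (hρ : 0 < ρ) (hb : 0 ≤ b) (hθ : 0 < θ) {Q' : S → ℝ}
    (hQ : Q ∈ stdSimplex ℝ S) (hQ' : Q' ∈ stdSimplex ℝ S) (hV : ∀ s, V s ∈ Set.Icc 0 b)
    (hgrid : ∀ k : ℕ, k * θ ≤ √(1 + ρ) * b / (√(1 + ρ) - 1) →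
      √(shortfallSq Q' V (k * θ)) ≤ √(shortfallSq Q V (k * θ)) + τ) :
    worst (chiSqBall ρ Q) V ≤ worst (chiSqBall ρ Q') V + (√(1 + ρ) * τ + θ) := by
  obtain ⟨η, hη, hdual⟩ := exists_worst_le_dualObj hρ hb hQ hV
  set k := ⌊η / θ⌋₊
  have hkη : k * θ ≤ η := (le_div_iff₀ hθ).1 (Nat.floor_le (div_nonneg hη.1 hθ.le))
  have hηk : η ≤ k * θ + θ := by
    have := (div_le_iff₀ hθ).1 (Nat.lt_floor_add_one (η / θ)).le
    linarith
  have hsqrt : √(shortfallSq Q' V (k * θ)) ≤ √(shortfallSq Q V η) + τ :=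
    (hgrid k (hkη.trans hη.2)).trans
      (add_le_add_left (Real.sqrt_le_sqrt (shortfallSq_mono hQ V hkη)) τ)
  calc worst (chiSqBall ρ Q) V ≤ η - √(1 + ρ) * √(shortfallSq Q V η) := hdual
    _ ≤ k * θ - √(1 + ρ) * √(shortfallSq Q' V (k * θ)) + (√(1 + ρ) * τ + θ) := by
      linarith [mul_le_mul_of_nonneg_left hsqrt (Real.sqrt_nonneg (1 + ρ))]
    _ ≤ _ := add_le_add_left (dualObj_le_worst hρ.le hQ' V (k * θ)) _

lemma abs_worst_chiSqBall_sub_le {θ τ : ℝ} (hρ : 0 < ρ) (hb : 0 ≤ b) (hθ : 0 < θ) {Q' : S → ℝ}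
    (hQ : Q ∈ stdSimplex ℝ S) (hQ' : Q' ∈ stdSimplex ℝ S) (hV : ∀ s, V s ∈ Set.Icc 0 b)
    (hgrid : ∀ k : ℕ, k * θ ≤ √(1 + ρ) * b / (√(1 + ρ) - 1) →
      |√(shortfallSq Q V (k * θ)) - √(shortfallSq Q' V (k * θ))| ≤ τ) :
    |worst (chiSqBall ρ Q) V - worst (chiSqBall ρ Q') V| ≤ √(1 + ρ) * τ + θ := by
  have hle := worst_chiSqBall_le_add (τ := τ) hρ hb hθ hQ hQ' hV
    fun k hk => by linarith [(abs_le.1 (hgrid k hk)).1]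
  have hge := worst_chiSqBall_le_add (τ := τ) hρ hb hθ hQ' hQ hV
    fun k hk => by linarith [(abs_le.1 (hgrid k hk)).2]
  exact abs_sub_le_iff.2 ⟨by linarith, by linarith⟩

end ChiSquareDuality

section PathValue

variable {S : Type*} {n : ℕ} {p : ℕ → S → S → ℝ}

lemma sum_fin_succ_arrow [Fintype S] (f : (Fin (n + 1) → S) → ℝ) :
    ∑ y, f y = ∑ s, ∑ z : Fin n → S, f (Fin.cons s z) := by
  rw [← (Fin.consEquiv fun _ : Fin (n + 1) => S).sum_comp, Fintype.sum_prod_type]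
  rfl

/-- The probability of the trajectory `x` given its first state, in the inhomogeneous Markov chain
with transition matrices `p k`. -/
def pathProb (p : ℕ → S → S → ℝ) (x : Fin (n + 1) → S) : ℝ :=
  ∏ k : Fin n, p k (x k.castSucc) (x k.succ)

/-- The total reward collected along the trajectory `x` at rates `R k`; nothing is collected in its
last state. -/
def pathReward (R : ℕ → S → ℝ) (x : Fin (n + 1) → S) : ℝ := ∑ k : Fin n, R k (x k.castSucc)

lemma pathProb_cons_cons (p : ℕ → S → S → ℝ) (s s' : S) (z : Fin n → S) :
    pathProb p (Fin.cons s (Fin.cons s' z : Fin (n + 1) → S) : Fin (n + 2) → S) =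
      p 0 s s' * pathProb (fun k => p (k + 1)) (Fin.cons s' z : Fin (n + 1) → S) :=
  Fin.prod_univ_succ _

lemma pathReward_cons_cons (R : ℕ → S → ℝ) (s s' : S) (z : Fin n → S) :
    pathReward R (Fin.cons s (Fin.cons s' z : Fin (n + 1) → S) : Fin (n + 2) → S) =
      R 0 s + pathReward (fun k => R (k + 1)) (Fin.cons s' z : Fin (n + 1) → S) :=
  Fin.sum_univ_succ _

variable [Fintype S]

lemma sum_pathProb (hp : ∀ k < n, ∀ s, ∑ s', p k s s' = 1) (s : S) :
    ∑ y : Fin n → S, pathProb p (Fin.cons s y : Fin (n + 1) → S) = 1 := by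
  induction n generalizing p s with
  | zero => simp [pathProb]
  | succ n ih =>
    simp_rw [sum_fin_succ_arrow, pathProb_cons_cons, ← Finset.mul_sum,
      ih fun k hk => hp (k + 1) (Nat.succ_lt_succ hk), mul_one]
    exact hp 0 n.succ_pos s

/-- The expected total reward over `n` steps from the state `s`, in the inhomogeneous Markov chain
with transition matrices `p k` and rewards `R k`. -/
def pathValue (n : ℕ) (p : ℕ → S → S → ℝ) (R : ℕ → S → ℝ) (s : S) : ℝ :=
  ∑ y : Fin n → S,
    pathProb p (Fin.cons s y : Fin (n + 1) → S) * pathReward R (Fin.cons s y : Fin (n + 1) → S)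

lemma pathValue_succ (hp : ∀ k < n + 1, ∀ s, ∑ s', p k s s' = 1) (R : ℕ → S → ℝ) (s : S) :
    pathValue (n + 1) p R s =
      R 0 s + expect (p 0 s) (pathValue n (fun k => p (k + 1)) fun k => R (k + 1)) := by
  have htail := sum_pathProb (p := fun k => p (k + 1)) fun k hk => hp (k + 1) (Nat.succ_lt_succ hk)
  simp_rw [pathValue, sum_fin_succ_arrow, pathProb_cons_cons, pathReward_cons_cons, mul_add,
    Finset.sum_add_distrib, mul_assoc, ← Finset.mul_sum, ← Finset.sum_mul, htail, one_mul,
    ← Finset.sum_mul, hp 0 n.succ_pos s, one_mul]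
  rfl

end PathValue

section DynamicProgramming

variable {S A : Type*} {H : ℕ} {r : Fin H → S → A → ℝ} {ρ e : ℝ}
  {P P₀ Q : Fin H → S → A → S → ℝ} {π : Fin H → S → A} {U : Fin (H + 1) → S → ℝ}

/-- The transition matrix of the policy `π` at time `k`, with junk value `0` from the horizon
on. -/
def stepProb (P : Fin H → S → A → S → ℝ) (π : Fin H → S → A) (k : ℕ) (s s' : S) : ℝ :=
  if hk : k < H then P ⟨k, hk⟩ s (π ⟨k, hk⟩ s) s' else 0

/-- The reward of the policy `π` at time `k`, with junk value `0` from the horizon on. -/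
def stepReward (r : Fin H → S → A → ℝ) (π : Fin H → S → A) (k : ℕ) (s : S) : ℝ :=
  if hk : k < H then r ⟨k, hk⟩ s (π ⟨k, hk⟩ s) else 0

variable [Fintype S]

/-- The value of the policy `π` in the model `P`, computed by the Bellman recursion; times run up
to and including `H`, where the value is `0`. -/
def policyValue (r : Fin H → S → A → ℝ) (P : Fin H → S → A → S → ℝ) (π : Fin H → S → A) :
    Fin (H + 1) → S → ℝ :=
  Fin.reverseInduction (motive := fun _ => S → ℝ) (fun _ => 0)
    (fun h V s => r h s (π h s) + expect (P h s (π h s)) V)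

lemma policyValue_last (s : S) : policyValue r P π (Fin.last H) s = 0 := by
  simp [policyValue]

lemma policyValue_castSucc (h : Fin H) (s : S) :
    policyValue r P π h.castSucc s =
      r h s (π h s) + expect (P h s (π h s)) (policyValue r P π h.succ) := by
  simp [policyValue]

lemma pathValue_eq_policyValue (hP : ∀ h s a, P h s a ∈ stdSimplex ℝ S) (j : Fin (H + 1)) :
    pathValue (H - j) (fun k => stepProb P π (j + k)) (fun k => stepReward r π (j + k)) =
      policyValue r P π j := by
  induction j using Fin.reverseInduction with
  | last =>
    funext s
    rw [policyValue_last, Fin.val_last, Nat.sub_self]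
    simp [pathValue, pathReward]
  | cast h ih =>
    have hsum : ∀ k < H - h - 1 + 1, ∀ s, ∑ s', stepProb P π (h + k) s s' = 1 := by
      intro k hk s
      have hk' : h + k < H := by omega
      simpa only [stepProb, hk', dif_pos] using (hP _ _ _).2
    funext s
    have hprob : stepProb P π h s = P h s (π h s) := by
      funext s'
      simp [stepProb]
    rw [Fin.val_castSucc, show H - (h : ℕ) = H - h - 1 + 1 by omega, pathValue_succ hsum,
      policyValue_castSucc, ← ih, add_zero, hprob]
    simp [stepReward, add_assoc, add_comm 1, Nat.sub_sub]

lemma value_eq_policyValue (hP : ∀ h s a, P h s a ∈ stdSimplex ℝ S) (h : Fin H) (s : S) :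
    value r P π h s = policyValue r P π h.castSucc s := by
  have hlt : ∀ k : Fin (H - h), (h : ℕ) + k < H := fun k => by omega
  simp only [← pathValue_eq_policyValue hP, value, pathValue, trajProb, trajReward, pathProb,
    pathReward, stepProb, stepReward, Fin.val_castSucc, hlt, dif_pos]

lemma le_policyValue (hP : ∀ h s a, P h s a ∈ stdSimplex ℝ S) (hlast : ∀ s, U (Fin.last H) s ≤ 0)
    (hstep : ∀ h s, U h.castSucc s ≤ r h s (π h s) + expect (P h s (π h s)) (U h.succ))
    (j : Fin (H + 1)) (s : S) : U j s ≤ policyValue r P π j s := by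
  induction j using Fin.reverseInduction generalizing s with
  | last => exact (hlast s).trans_eq (policyValue_last s).symm
  | cast h ih =>
    rw [policyValue_castSucc]
    exact (hstep h s).trans (add_le_add_right (expect_mono (hP _ _ _) ih) _)

lemma policyValue_le (hP : ∀ h s a, P h s a ∈ stdSimplex ℝ S) (hlast : ∀ s, 0 ≤ U (Fin.last H) s)
    (hstep : ∀ h s, r h s (π h s) + expect (P h s (π h s)) (U h.succ) ≤ U h.castSucc s)
    (j : Fin (H + 1)) (s : S) : policyValue r P π j s ≤ U j s := by
  induction j using Fin.reverseInduction generalizing s with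
  | last => exact (policyValue_last s).trans_le (hlast s)
  | cast h ih =>
    rw [policyValue_castSucc]
    exact (add_le_add_right (expect_mono (hP _ _ _) ih) _).trans (hstep h s)

lemma value_nonneg (hr : ∀ h s a, 0 ≤ r h s a) (hP : ∀ h s a s', 0 ≤ P h s a s')
    (π : Fin H → S → A) (h : Fin H) (s : S) : 0 ≤ value r P π h s :=
  Finset.sum_nonneg fun _ _ => mul_nonneg (Finset.prod_nonneg fun _ _ => hP _ _ _ _)
    (Finset.sum_nonneg fun _ _ => hr _ _ _)

lemma rpvlValue_last : rpvlValue r ρ Q (Fin.last H) = fun _ => 0 := by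
  simp [rpvlValue]

lemma rpvlValue_castSucc (h : Fin H) :
    rpvlValue r ρ Q h.castSucc = fun s => ⨆ a, robustQ r ρ Q (rpvlValue r ρ Q h.succ) h s a := by
  simp [rpvlValue]

lemma rpvlValue_congr {Q' : Fin H → S → A → S → ℝ} (j : Fin (H + 1))
    (hQ : ∀ h : Fin H, j ≤ h.castSucc → Q h = Q' h) :
    rpvlValue r ρ Q j = rpvlValue r ρ Q' j := by
  induction j using Fin.reverseInduction with
  | last => rw [rpvlValue_last, rpvlValue_last]
  | cast h ih =>
    rw [rpvlValue_castSucc, rpvlValue_castSucc,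
      ih fun h' hh' => hQ h' ((Fin.castSucc_le_succ h).trans hh')]
    simp only [robustQ, hQ h le_rfl]

lemma robustQ_le_rpvlValue [Finite A] (h : Fin H) (s : S) (a : A) :
    robustQ r ρ Q (rpvlValue r ρ Q h.succ) h s a ≤ rpvlValue r ρ Q h.castSucc s := by
  rw [rpvlValue_castSucc]
  exact le_ciSup (f := robustQ r ρ Q (rpvlValue r ρ Q h.succ) h s)
    (Set.finite_range _).bddAbove a

lemma rpvlValue_mem_Icc [Finite A] [Nonempty A] (hr : ∀ h s a, r h s a ∈ Set.Icc (0 : ℝ) 1)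
    (hQ : ∀ h s a, Q h s a ∈ stdSimplex ℝ S) (j : Fin (H + 1)) (s : S) :
    rpvlValue r ρ Q j s ∈ Set.Icc (0 : ℝ) H := by
  suffices h : ∀ s, rpvlValue r ρ Q j s ∈ Set.Icc (0 : ℝ) (H - (j : ℕ)) from
    ⟨(h s).1, (h s).2.trans (by simp)⟩
  induction j using Fin.reverseInduction with
  | last => simp [rpvlValue_last]
  | cast h ih =>
    intro s
    have hrobustQ : ∀ a, robustQ r ρ Q (rpvlValue r ρ Q h.succ) h s a ∈
        Set.Icc (0 : ℝ) (H - (h : ℕ)) := by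
      intro a
      have hworst := worst_mem_Icc (chiSqBall_subset_stdSimplex (ρ := ρ) (Q := Q h s a))
        ⟨_, self_mem_chiSqBall (hQ h s a)⟩ ih
      have hreward := hr h s a
      simp only [Fin.val_succ, Nat.cast_add, Nat.cast_one, Set.mem_Icc, robustQ] at *
      constructor <;> linarith
    obtain ⟨a⟩ := ‹Nonempty A›
    refine ⟨(hrobustQ a).1.trans (robustQ_le_rpvlValue h s a), ?_⟩
    have : Nonempty A := ⟨a⟩
    rw [rpvlValue_castSucc]
    exact ciSup_le fun a => (hrobustQ a).2

/-- The policy `π` is greedy for robust dynamic programming around the model `Q`: it attains the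
maximum in the recursion of `rpvlValue` at every time and state. -/
def IsRobustGreedy (r : Fin H → S → A → ℝ) (ρ : ℝ) (Q : Fin H → S → A → S → ℝ)
    (π : Fin H → S → A) : Prop :=
  ∀ h s a, robustQ r ρ Q (rpvlValue r ρ Q h.succ) h s a ≤
    robustQ r ρ Q (rpvlValue r ρ Q h.succ) h s (π h s)

lemma IsRobustGreedy.rpvlValue_le (hπ : IsRobustGreedy r ρ Q π) (h : Fin H) (s : S) :
    rpvlValue r ρ Q h.castSucc s ≤ robustQ r ρ Q (rpvlValue r ρ Q h.succ) h s (π h s) := by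
  have : Nonempty A := ⟨π h s⟩
  rw [rpvlValue_castSucc]
  exact ciSup_le (hπ h s)

lemma cast_sub_castSucc_eq (h : Fin H) :
    (H : ℝ) - (h.castSucc : ℕ) = H - (h.succ : ℕ) + 1 := by
  rw [Fin.val_succ, Fin.val_castSucc]
  push_cast
  ring

lemma IsRobustGreedy.rpvlValue_sub_le_value (hπ : IsRobustGreedy r ρ Q π)
    (he : ∀ h s a, worst (chiSqBall ρ (Q h s a)) (rpvlValue r ρ Q h.succ) ≤
      worst (chiSqBall ρ (P₀ h s a)) (rpvlValue r ρ Q h.succ) + e)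
    (hP : P ∈ uncertaintySet ρ P₀) (h : Fin H) (s : S) :
    rpvlValue r ρ Q h.castSucc s - (H - h) * e ≤ value r P π h s := by
  have hP' : ∀ h s a, P h s a ∈ stdSimplex ℝ S := fun h s a => (hP h s a).1
  rw [value_eq_policyValue hP', sub_eq_add_neg]
  refine le_policyValue (U := fun j s => rpvlValue r ρ Q j s + -((H - (j : ℕ)) * e)) hP'
    (fun s => by simp [rpvlValue_last]) (fun h s => ?_) h.castSucc s
  rw [expect_add_const (hP' h s (π h s)), cast_sub_castSucc_eq]
  have hgreedy := hπ.rpvlValue_le h s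
  have hmodel := worst_le_expect chiSqBall_subset_stdSimplex (hP h s (π h s))
    (rpvlValue r ρ Q h.succ)
  unfold robustQ at hgreedy
  linarith [he h s (π h s)]

lemma exists_value_le_rpvlValue_add [Finite A] (hρ : 0 ≤ ρ)
    (hP₀ : ∀ h s a, P₀ h s a ∈ stdSimplex ℝ S)
    (he : ∀ h s a, worst (chiSqBall ρ (P₀ h s a)) (rpvlValue r ρ Q h.succ) ≤
      worst (chiSqBall ρ (Q h s a)) (rpvlValue r ρ Q h.succ) + e) :
    ∃ P ∈ uncertaintySet ρ P₀, ∀ (π : Fin H → S → A) h s,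
      value r P π h s ≤ rpvlValue r ρ Q h.castSucc s + (H - h) * e := by
  choose P hP hworst using fun h s a =>
    exists_expect_eq_worst hρ (hP₀ h s a) (rpvlValue r ρ Q h.succ)
  have hP' : ∀ h s a, P h s a ∈ stdSimplex ℝ S := fun h s a => (hP h s a).1
  refine ⟨P, hP, fun π h s => ?_⟩
  rw [value_eq_policyValue hP']
  refine policyValue_le (U := fun j s => rpvlValue r ρ Q j s + (H - (j : ℕ)) * e) hP'
    (fun s => by simp [rpvlValue_last]) (fun h s => ?_) h.castSucc s
  rw [expect_add_const (hP' h s (π h s)), cast_sub_castSucc_eq, hworst]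
  have hmax := robustQ_le_rpvlValue (r := r) (ρ := ρ) (Q := Q) h s (π h s)
  unfold robustQ at hmax
  linarith [he h s (π h s)]

lemma IsRobustGreedy.abs_optRobustValue_sub_le [Finite A] (hπ : IsRobustGreedy r ρ Q π)
    (hr : ∀ h s a, 0 ≤ r h s a) (hρ : 0 ≤ ρ) (hP₀ : ∀ h s a, P₀ h s a ∈ stdSimplex ℝ S)
    (he : ∀ h s a, |worst (chiSqBall ρ (P₀ h s a)) (rpvlValue r ρ Q h.succ) -
      worst (chiSqBall ρ (Q h s a)) (rpvlValue r ρ Q h.succ)| ≤ e) (h : Fin H) (s : S) :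
    |optRobustValue r ρ P₀ h s - robustValue r ρ P₀ π h s| ≤ 2 * (H - h) * e := by
  have : Nonempty (uncertaintySet ρ P₀) := ⟨P₀, fun h s a => self_mem_chiSqBall (hP₀ h s a)⟩
  have : Nonempty (Fin H → S → A) := ⟨π⟩
  have hbdd : ∀ π', BddBelow (Set.range fun P : uncertaintySet ρ P₀ => value r P.1 π' h s) :=
    fun π' => ⟨0, Set.forall_mem_range.2 fun P =>
      value_nonneg hr (fun h s a => (P.2 h s a).1.1) π' h s⟩
  have hle : robustValue r ρ P₀ π h s ≤ optRobustValue r ρ P₀ h s :=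
    le_ciSup (f := fun π' => robustValue r ρ P₀ π' h s) (Set.finite_range _).bddAbove π
  have hlower : rpvlValue r ρ Q h.castSucc s - (H - h) * e ≤ robustValue r ρ P₀ π h s :=
    le_ciInf fun P => hπ.rpvlValue_sub_le_value
      (fun h s a => by linarith [(abs_le.1 (he h s a)).1]) P.2 h s
  have hupper : optRobustValue r ρ P₀ h s ≤ rpvlValue r ρ Q h.castSucc s + (H - h) * e := by
    obtain ⟨P, hP, hvalue⟩ := exists_value_le_rpvlValue_add (r := r) (Q := Q) (e := e) hρ hP₀
      fun h s a => by linarith [(abs_le.1 (he h s a)).2]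
    exact ciSup_le fun π' => (ciInf_le (hbdd π') ⟨P, hP⟩).trans (hvalue π' h s)
  rw [abs_of_nonneg (sub_nonneg.2 hle)]
  linarith

end DynamicProgramming

section SqrtConcentration

variable {Ω ι : Type*} [MeasurableSpace Ω] {μ : Measure Ω} [IsProbabilityMeasure μ]

lemma mgf_le_exp_integral_mul {Y : Ω → ℝ} (hm : AEMeasurable Y μ)
    (hY : ∀ᵐ ω ∂μ, Y ω ∈ Set.Icc 0 1) (t : ℝ) :
    mgf Y μ t ≤ Real.exp (μ[Y] * (Real.exp t - 1)) := by
  have hint : Integrable Y μ := .of_mem_Icc 0 1 hm hY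
  calc mgf Y μ t ≤ ∫ ω, (1 + Y ω * (Real.exp t - 1)) ∂μ := by
        refine integral_mono_ae (integrable_exp_mul_of_mem_Icc hm hY)
          ((integrable_const 1).add (hint.mul_const _)) (hY.mono fun ω hω => ?_)
        have hchord := convexOn_exp.2 (Set.mem_univ 0) (Set.mem_univ t)
          (sub_nonneg.2 hω.2) hω.1 (sub_add_cancel 1 (Y ω))
        simp only [smul_eq_mul, mul_zero, zero_add, Real.exp_zero, mul_one] at hchord
        change Real.exp (t * Y ω) ≤ 1 + Y ω * (Real.exp t - 1)
        rw [mul_comm t]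
        linarith
    _ = μ[Y] * (Real.exp t - 1) + 1 := by
        rw [integral_add (integrable_const 1) (hint.mul_const _), integral_mul_const]
        simp [add_comm]
    _ ≤ _ := Real.add_one_le_exp _

lemma chernoff_exponent_le {a b : ℝ} (ha : 0 ≤ a) (hb : 0 < b) :
    a ^ 2 * (Real.exp (1 - a / b) - 1) - (1 - a / b) * b ^ 2 ≤ -(b - a) ^ 2 := by
  have hexp : a / b * Real.exp (1 - a / b) ≤ 1 := by
    have hle : a / b ≤ Real.exp (a / b - 1) := by linarith [Real.add_one_le_exp (a / b - 1)]
    calc a / b * Real.exp (1 - a / b)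
        ≤ Real.exp (a / b - 1) * Real.exp (1 - a / b) := by gcongr
      _ = 1 := by rw [← Real.exp_add, sub_add_sub_cancel, sub_self, Real.exp_zero]
  calc a ^ 2 * (Real.exp (1 - a / b) - 1) - (1 - a / b) * b ^ 2
      = a * b * (a / b * Real.exp (1 - a / b)) - a ^ 2 - b ^ 2 + a * b := by
        field_simp
        ring
    _ ≤ a * b * 1 - a ^ 2 - b ^ 2 + a * b := by gcongr
    _ = -(b - a) ^ 2 := by ring

variable [Fintype ι] {Y : ι → Ω → ℝ}

lemma integrable_exp_mul_sum (hm : ∀ i, Measurable (Y i)) (hY : ∀ i ω, Y i ω ∈ Set.Icc 0 1)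
    (t : ℝ) : Integrable (fun ω => Real.exp (t * ∑ i, Y i ω)) μ := by
  refine integrable_exp_mul_of_mem_Icc (a := 0) (b := Fintype.card ι) (by fun_prop)
    (ae_of_all _ fun ω => ⟨Finset.sum_nonneg fun i _ => (hY i ω).1, ?_⟩)
  simpa using Finset.sum_le_card_nsmul Finset.univ (Y · ω) 1 fun i _ => (hY i ω).2

lemma mgf_sum_le_exp_sum_integral_mul (hind : iIndepFun Y μ) (hm : ∀ i, Measurable (Y i))
    (hY : ∀ i ω, Y i ω ∈ Set.Icc 0 1) (t : ℝ) :
    mgf (fun ω => ∑ i, Y i ω) μ t ≤ Real.exp ((∑ i, μ[Y i]) * (Real.exp t - 1)) := by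
  have hprod := hind.mgf_sum (t := t) hm Finset.univ
  rw [Finset.sum_fn] at hprod
  rw [hprod, Finset.sum_mul, Real.exp_sum]
  exact Finset.prod_le_prod (fun i _ => mgf_nonneg) fun i _ =>
    mgf_le_exp_integral_mul (hm i).aemeasurable (ae_of_all _ (hY i)) t

-- Both tails use the exponent `1 - a / b`, where `a ^ 2` is the mean and `b ^ 2` the threshold;
-- the optimal `2 * log (b / a)` degenerates at mean `0` and gains nothing in the final bound.
lemma exp_mul_mgf_sum_le (hind : iIndepFun Y μ) (hm : ∀ i, Measurable (Y i))
    (hY : ∀ i ω, Y i ω ∈ Set.Icc 0 1) {b : ℝ} (hb : 0 < b) :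
    Real.exp (-(1 - √(∑ i, μ[Y i]) / b) * b ^ 2) *
        mgf (fun ω => ∑ i, Y i ω) μ (1 - √(∑ i, μ[Y i]) / b) ≤
      Real.exp (-(b - √(∑ i, μ[Y i])) ^ 2) := by
  have hmean : 0 ≤ ∑ i, μ[Y i] :=
    Finset.sum_nonneg fun i _ => integral_nonneg fun ω => (hY i ω).1
  have hexponent := chernoff_exponent_le (Real.sqrt_nonneg (∑ i, μ[Y i])) hb
  rw [Real.sq_sqrt hmean] at hexponent
  refine (mul_le_mul_of_nonneg_left (mgf_sum_le_exp_sum_integral_mul hind hm hY _)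
    (Real.exp_nonneg _)).trans ?_
  rw [← Real.exp_add, Real.exp_le_exp]
  linarith

lemma measureReal_sq_le_sum_le (hind : iIndepFun Y μ) (hm : ∀ i, Measurable (Y i))
    (hY : ∀ i ω, Y i ω ∈ Set.Icc 0 1) {b : ℝ} (hb : 0 < b) (hle : √(∑ i, μ[Y i]) ≤ b) :
    μ.real {ω | b ^ 2 ≤ ∑ i, Y i ω} ≤ Real.exp (-(b - √(∑ i, μ[Y i])) ^ 2) :=
  (measure_ge_le_exp_mul_mgf _ (sub_nonneg.2 ((div_le_one hb).2 hle))
    (integrable_exp_mul_sum hm hY _)).trans (exp_mul_mgf_sum_le hind hm hY hb)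

lemma measureReal_sum_le_sq_le (hind : iIndepFun Y μ) (hm : ∀ i, Measurable (Y i))
    (hY : ∀ i ω, Y i ω ∈ Set.Icc 0 1) {b : ℝ} (hb : 0 < b) (hle : b ≤ √(∑ i, μ[Y i])) :
    μ.real {ω | ∑ i, Y i ω ≤ b ^ 2} ≤ Real.exp (-(b - √(∑ i, μ[Y i])) ^ 2) :=
  (measure_le_le_exp_mul_mgf _ (sub_nonpos.2 ((one_le_div hb).2 hle))
    (integrable_exp_mul_sum hm hY _)).trans (exp_mul_mgf_sum_le hind hm hY hb)

theorem measureReal_lt_abs_sqrt_sum_sub_le (hind : iIndepFun Y μ) (hm : ∀ i, Measurable (Y i))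
    (hY : ∀ i ω, Y i ω ∈ Set.Icc 0 1) {c : ℝ} (hc : 0 < c) :
    μ.real {ω | c < |√(∑ i, Y i ω) - √(∑ i, μ[Y i])|} ≤ 2 * Real.exp (-c ^ 2) := by
  set a := √(∑ i, μ[Y i]) with ha_def
  have ha : 0 ≤ a := Real.sqrt_nonneg _
  have hupper : μ.real {ω | (a + c) ^ 2 ≤ ∑ i, Y i ω} ≤ Real.exp (-c ^ 2) := by
    have htail := measureReal_sq_le_sum_le hind hm hY (b := a + c) (by linarith) (by linarith)
    rwa [← ha_def, add_sub_cancel_left] at htail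
  have hlower : μ.real {ω | 0 < a - c ∧ ∑ i, Y i ω ≤ (a - c) ^ 2} ≤ Real.exp (-c ^ 2) := by
    by_cases hac : 0 < a - c
    · have htail := measureReal_sum_le_sq_le hind hm hY hac (by linarith)
      rw [← ha_def, sub_sub_cancel_left, neg_sq] at htail
      simpa only [hac, true_and] using htail
    · simp [hac, Real.exp_nonneg]
  have hsub : {ω | c < |√(∑ i, Y i ω) - a|} ⊆
      {ω | (a + c) ^ 2 ≤ ∑ i, Y i ω} ∪ {ω | 0 < a - c ∧ ∑ i, Y i ω ≤ (a - c) ^ 2} := by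
    intro ω (hω : c < |√(∑ i, Y i ω) - a|)
    rcases lt_abs.1 hω with hgt | hlt
    · exact .inl (Real.lt_sqrt (by linarith) |>.1 (by linarith)).le
    · have hac : √(∑ i, Y i ω) < a - c := by linarith
      have hpos : 0 < a - c := (Real.sqrt_nonneg _).trans_lt hac
      exact .inr ⟨hpos, ((Real.sqrt_lt' hpos).1 hac).le⟩
  linarith [measureReal_mono (μ := μ) hsub,
    measureReal_union_le (μ := μ) {ω | (a + c) ^ 2 ≤ ∑ i, Y i ω}
      {ω | 0 < a - c ∧ ∑ i, Y i ω ≤ (a - c) ^ 2}]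

end SqrtConcentration

section EmpiricalMeans

variable {S A Ω : Type*} [Fintype S]

lemma empirical_mem_stdSimplex [DecidableEq S] {H N : ℕ} (hN : 0 < N)
    (x : Fin H → S → A → Fin N → S) (h : Fin H) (s : S) (a : A) :
    empirical x h s a ∈ stdSimplex ℝ S := by
  refine ⟨fun s' => div_nonneg (Nat.cast_nonneg _) (Nat.cast_nonneg _), ?_⟩
  simp only [empirical]
  rw [← Finset.sum_div, ← Nat.cast_sum,
    ← Finset.card_eq_sum_card_fiberwise (f := x h s a) fun _ _ => Finset.mem_univ _,
    Finset.card_univ, Fintype.card_fin, div_self (Nat.cast_ne_zero.2 hN.ne')]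

lemma expect_empirical [DecidableEq S] {H N : ℕ} (x : Fin H → S → A → Fin N → S) (h : Fin H)
    (s : S) (a : A) (f : S → ℝ) :
    expect (empirical x h s a) f = (∑ i, f (x h s a i)) / N := by
  simp only [expect, empirical, div_mul_eq_mul_div]
  rw [← Finset.sum_div, ← Finset.sum_fiberwise' (s := Finset.univ) (x h s a) f]
  simp only [Finset.sum_const, nsmul_eq_mul]

variable [MeasurableSpace S] [MeasurableSingletonClass S] [MeasurableSpace Ω] {μ : Measure Ω}
  [IsProbabilityMeasure μ]

lemma integral_comp_eq_expect {Z : Ω → S} (hZ : Measurable Z) {P : S → ℝ}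
    (hlaw : ∀ s, μ.real {ω | Z ω = s} = P s) (f : S → ℝ) : ∫ ω, f (Z ω) ∂μ = expect P f := by
  have := Measure.isProbabilityMeasure_map (μ := μ) hZ.aemeasurable
  rw [← integral_map hZ.aemeasurable (f := f) (measurable_of_finite f).aestronglyMeasurable,
    integral_fintype .of_finite]
  refine Finset.sum_congr rfl fun s _ => ?_
  rw [map_measureReal_apply hZ (measurableSet_singleton s), ← hlaw s]
  rfl

theorem measureReal_lt_abs_sqrt_mean_sub_sqrt_expect_le {N : ℕ} (hN : 0 < N)
    {Z : Fin N → Ω → S} (hind : iIndepFun Z μ) (hm : ∀ i, Measurable (Z i)) {P : S → ℝ}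
    (hlaw : ∀ i s, μ.real {ω | Z i ω = s} = P s) {f : S → ℝ} {B : ℝ} (hB : 0 < B)
    (hf : ∀ s, f s ∈ Set.Icc 0 B) {τ : ℝ} (hτ : 0 < τ) :
    μ.real {ω | τ < |√((∑ i, f (Z i ω)) / N) - √(expect P f)|} ≤
      2 * Real.exp (-(N * τ ^ 2 / B)) := by
  have hNB : 0 < N / B := div_pos (Nat.cast_pos.2 hN) hB
  have hfm : Measurable f := measurable_of_finite f
  have hmean : ∑ i, ∫ ω, f (Z i ω) / B ∂μ = expect P f * (N / B) := by
    simp only [integral_div, integral_comp_eq_expect (hm _) (hlaw _), Finset.sum_const,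
      Finset.card_univ, Fintype.card_fin, nsmul_eq_mul]
    ring
  have hsum (ω : Ω) : ∑ i, f (Z i ω) / B = (∑ i, f (Z i ω)) / N * (N / B) := by
    rw [← Finset.sum_div]
    field_simp
  have hconc := measureReal_lt_abs_sqrt_sum_sub_le (μ := μ) (Y := fun i ω => f (Z i ω) / B)
    (hind.comp (fun _ s => f s / B) fun _ => hfm.div_const B)
    (fun i => (hfm.comp (hm i)).div_const B)
    (fun i ω => ⟨div_nonneg (hf _).1 hB.le, (div_le_one hB).2 (hf _).2⟩)
    (mul_pos hτ (Real.sqrt_pos.2 hNB))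
  simp only [hmean, hsum, Real.sqrt_mul' _ hNB.le, ← sub_mul, abs_mul,
    abs_of_pos (Real.sqrt_pos.2 hNB), mul_lt_mul_iff_left₀ (Real.sqrt_pos.2 hNB), mul_pow,
    Real.sq_sqrt hNB.le] at hconc
  rwa [mul_div_assoc', mul_comm (τ ^ 2)] at hconc

lemma measureReal_lt_abs_sqrt_mean_sub_sqrt_shortfallSq_le {N : ℕ} (hN : 0 < N)
    {Z : Fin N → Ω → S} (hind : iIndepFun Z μ) (hm : ∀ i, Measurable (Z i)) {P : S → ℝ}
    (hlaw : ∀ i s, μ.real {ω | Z i ω = s} = P s) {V : S → ℝ} (hV : ∀ s, 0 ≤ V s) {η K τ : ℝ}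
    (hη : η ≤ K) (hK : 0 < K) (hτ : 0 < τ) :
    μ.real {ω | τ < |√((∑ i, max (η - V (Z i ω)) 0 ^ 2) / N) - √(shortfallSq P V η)|} ≤
      2 * Real.exp (-(N * τ ^ 2 / K ^ 2)) :=
  measureReal_lt_abs_sqrt_mean_sub_sqrt_expect_le hN hind hm hlaw (pow_pos hK 2)
    (f := fun s => max (η - V s) 0 ^ 2)
    (fun s => ⟨sq_nonneg _, pow_le_pow_left₀ (le_max_right _ _)
      (max_le (by linarith [hV s]) hK.le) 2⟩) hτ

end EmpiricalMeans

section SampleSplitting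

lemma measureReal_mem_le_of_indepFun {Ω α β : Type*} [MeasurableSpace Ω] [MeasurableSpace α]
    [MeasurableSpace β] {μ : Measure Ω} [IsProbabilityMeasure μ] {W : Ω → α} {Z : Ω → β}
    (hW : Measurable W) (hZ : Measurable Z) (hind : IndepFun W Z μ) {B : Set (α × β)}
    (hB : MeasurableSet B) {c : ℝ} (hc : ∀ w, μ.real {ω | (w, Z ω) ∈ B} ≤ c) :
    μ.real {ω | (W ω, Z ω) ∈ B} ≤ c := by
  have := Measure.isProbabilityMeasure_map (μ := μ) hW.aemeasurable
  have := Measure.isProbabilityMeasure_map (μ := μ) hZ.aemeasurable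
  obtain ⟨ω₀⟩ := nonempty_of_isProbabilityMeasure μ
  have hsection (w : α) : μ.map Z (Prod.mk w ⁻¹' B) ≤ ENNReal.ofReal c := by
    rw [Measure.map_apply hZ (measurable_prodMk_left hB)]
    exact (ENNReal.le_ofReal_iff_toReal_le (measure_ne_top _ _)
      (measureReal_nonneg.trans (hc w))).2 (hc w)
  refine ENNReal.toReal_le_of_le_ofReal (measureReal_nonneg.trans (hc (W ω₀))) ?_
  calc μ {ω | (W ω, Z ω) ∈ B} = (μ.map W).prod (μ.map Z) B := by
        rw [← (indepFun_iff_map_prod_eq_prod_map_map hW.aemeasurable hZ.aemeasurable).1 hind,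
          Measure.map_apply (hW.prodMk hZ) hB]
        rfl
    _ = ∫⁻ w, μ.map Z (Prod.mk w ⁻¹' B) ∂μ.map W := Measure.prod_apply hB
    _ ≤ ∫⁻ _, ENNReal.ofReal c ∂μ.map W := lintegral_mono hsection
    _ = ENNReal.ofReal c := by simp

variable {S A Ω : Type*} {H N : ℕ}

/-- The array of samples drawn at the outcome `ω`, in the form in which the algorithm reads it. -/
abbrev sampleAt (X : Fin H → S → A → Fin N → Ω → S) (ω : Ω) : Fin H → S → A → Fin N → S :=
  fun h s a i => X h s a i ω

/-- The part of the sample array `x` drawn at the stages after `h`, with the remaining entries set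
to the dummy value `s₀` so that it is again a sample array. -/
def laterSample (h : Fin H) (s₀ : S) (x : Fin H → S → A → Fin N → S) : Fin H → S → A → Fin N → S :=
  fun h' => if h < h' then x h' else fun _ _ _ => s₀

lemma rpvlValue_empirical_laterSample [Fintype S] [DecidableEq S] (r : Fin H → S → A → ℝ) (ρ : ℝ)
    (x : Fin H → S → A → Fin N → S) (h : Fin H) (s₀ : S) :
    rpvlValue r ρ (empirical (laterSample h s₀ x)) h.succ = rpvlValue r ρ (empirical x) h.succ :=
  rpvlValue_congr h.succ fun h' hh' => by
    have hlt : h < h' := Fin.succ_le_castSucc_iff.1 hh'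
    funext s a s'
    simp only [empirical, laterSample, hlt, if_true]

variable [MeasurableSpace S] [MeasurableSpace Ω] {μ : Measure Ω} {P₀ : Fin H → S → A → S → ℝ}
  {X : Fin H → S → A → Fin N → Ω → S}

lemma IsGenerativeSample.measurable_sampleAt (hX : IsGenerativeSample μ P₀ X) :
    Measurable (sampleAt X) := by
  have := hX.measurable
  unfold sampleAt
  fun_prop

lemma IsGenerativeSample.indepFun_laterSample [Finite S] [MeasurableSingletonClass S] [Finite A]
    (hX : IsGenerativeSample μ P₀ X) (h : Fin H) (s₀ : S) :
    IndepFun (fun ω => laterSample h s₀ (sampleAt X ω)) (fun ω => sampleAt X ω h) μ := by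
  classical
  have := Fintype.ofFinite S
  have := Fintype.ofFinite A
  let later : Finset (Fin H × S × A × Fin N) := {j | h < j.1}
  let now : Finset (Fin H × S × A × Fin N) := {j | j.1 = h}
  have hlater {h' : Fin H} (hh : h < h') (s : S) (a : A) (i : Fin N) : (h', s, a, i) ∈ later :=
    Finset.mem_filter.2 ⟨Finset.mem_univ _, hh⟩
  have hnow (s : S) (a : A) (i : Fin N) : (h, s, a, i) ∈ now :=
    Finset.mem_filter.2 ⟨Finset.mem_univ _, rfl⟩
  have hdisj : Disjoint later now := Finset.disjoint_left.2 fun j hj hj' =>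
    (Finset.mem_filter.1 hj).2.ne' (Finset.mem_filter.1 hj').2
  have hind := hX.indep.indepFun_finset later now hdisj fun j => hX.measurable _ _ _ _
  let extend (w : later → S) : Fin H → S → A → Fin N → S := fun h' s a i =>
    if hh : h < h' then w ⟨(h', s, a, i), hlater hh s a i⟩ else s₀
  let restrict (z : now → S) : S → A → Fin N → S := fun s a i => z ⟨(h, s, a, i), hnow s a i⟩
  convert hind.comp (φ := extend) (ψ := restrict) .of_discrete .of_discrete using 1
  · ext ω h' s a i
    by_cases hh : h < h' <;> simp [laterSample, extend, hh]
  · rfl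

end SampleSplitting

section RPVL

variable {S A Ω : Type*} [Fintype S] [DecidableEq S] {H N : ℕ}

/-- The error made at the level `η` in the only statistic of the transition law at `(h, s, a)`
through which the dual of the robust Bellman update depends on it, at the next value function
computed by the algorithm from the samples `x`. -/
def shortfallError (r : Fin H → S → A → ℝ) (ρ : ℝ) (P₀ : Fin H → S → A → S → ℝ)
    (x : Fin H → S → A → Fin N → S) (h : Fin H) (s : S) (a : A) (η : ℝ) : ℝ :=
  |√(shortfallSq (P₀ h s a) (rpvlValue r ρ (empirical x) h.succ) η) -
    √(shortfallSq (empirical x h s a) (rpvlValue r ρ (empirical x) h.succ) η)|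

lemma shortfallError_eq (r : Fin H → S → A → ℝ) (ρ : ℝ) (P₀ : Fin H → S → A → S → ℝ)
    (x : Fin H → S → A → Fin N → S) (h : Fin H) (s : S) (a : A) (η : ℝ) (s₀ : S) :
    shortfallError r ρ P₀ x h s a η =
      |√((∑ i, max (η - rpvlValue r ρ (empirical (laterSample h s₀ x)) h.succ (x h s a i)) 0 ^ 2) /
          N) -
        √(shortfallSq (P₀ h s a) (rpvlValue r ρ (empirical (laterSample h s₀ x)) h.succ) η)| := by
  rw [rpvlValue_empirical_laterSample, shortfallError, abs_sub_comm, shortfallSq, expect_empirical]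

variable {r : Fin H → S → A → ℝ} {P₀ : Fin H → S → A → S → ℝ}

lemma IsRPVLOutput.abs_optRobustValue_sub_le [Finite A] [Nonempty A] (hN : 0 < N)
    (hr : ∀ h s a, r h s a ∈ Set.Icc (0 : ℝ) 1) (hP₀ : ∀ h s a, P₀ h s a ∈ stdSimplex ℝ S)
    {ρ τ θ : ℝ} (hρ : 0 < ρ) (hτ : 0 ≤ τ) (hθ : 0 < θ) {x : Fin H → S → A → Fin N → S}
    (herror : ∀ h s a, ∀ k : ℕ, k * θ ≤ √(1 + ρ) * H / (√(1 + ρ) - 1) →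
      shortfallError r ρ P₀ x h s a (k * θ) ≤ τ)
    {π : Fin H → S → A} (hπ : IsRPVLOutput r ρ x π) (h : Fin H) (s : S) :
    |optRobustValue r ρ P₀ h s - robustValue r ρ P₀ π h s| ≤ 2 * H * (√(1 + ρ) * τ + θ) := by
  have hQ := empirical_mem_stdSimplex hN x
  have hgreedy : IsRobustGreedy r ρ (empirical x) π := hπ
  refine (hgreedy.abs_optRobustValue_sub_le (fun h s a => (hr h s a).1) hρ.le hP₀
    (fun h s a => abs_worst_chiSqBall_sub_le hρ (Nat.cast_nonneg H) hθ (hP₀ h s a) (hQ h s a)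
      (rpvlValue_mem_Icc hr hQ h.succ) (herror h s a)) h s).trans ?_
  gcongr
  linarith [Nat.cast_nonneg (α := ℝ) (h : ℕ)]

variable [Nonempty A] [MeasurableSpace S] [MeasurableSingletonClass S] [MeasurableSpace Ω]
  {μ : Measure Ω} [IsProbabilityMeasure μ] {X : Fin H → S → A → Fin N → Ω → S}

lemma IsGenerativeSample.measureReal_lt_shortfallError_le [Finite A]
    (hX : IsGenerativeSample μ P₀ X) (hN : 0 < N) (hr : ∀ h s a, r h s a ∈ Set.Icc (0 : ℝ) 1)
    (ρ : ℝ) {η K τ : ℝ} (hη : η ≤ K) (hK : 0 < K) (hτ : 0 < τ) (h : Fin H) (s : S) (a : A) :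
    μ.real {ω | τ < shortfallError r ρ P₀ (sampleAt X ω) h s a η} ≤
      2 * Real.exp (-(N * τ ^ 2 / K ^ 2)) := by
  let V (w : Fin H → S → A → Fin N → S) : S → ℝ := rpvlValue r ρ (empirical w) h.succ
  let B : Set ((Fin H → S → A → Fin N → S) × (S → A → Fin N → S)) := {p | τ <
    |√((∑ i, max (η - V p.1 (p.2 s a i)) 0 ^ 2) / N) - √(shortfallSq (P₀ h s a) (V p.1) η)|}
  have hW : Measurable fun ω => laterSample h s (sampleAt X ω) :=
    (measurable_of_finite (laterSample h s)).comp hX.measurable_sampleAt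
  have hZ : Measurable fun ω => sampleAt X ω h :=
    (measurable_pi_apply h).comp hX.measurable_sampleAt
  have hiid : iIndepFun (X h s a) μ :=
    hX.indep.precomp (g := fun i => (h, s, a, i)) fun i j hij => by simpa using hij
  simp only [shortfallError_eq (s₀ := s)]
  exact measureReal_mem_le_of_indepFun hW hZ (hX.indepFun_laterSample h s) (B := B)
    B.toFinite.measurableSet fun w =>
      measureReal_lt_abs_sqrt_mean_sub_sqrt_shortfallSq_le hN hiid (hX.measurable h s a)
        (hX.law h s a)
        (fun s' => (rpvlValue_mem_Icc hr (empirical_mem_stdSimplex hN w) h.succ s').1) hη hK hτ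

lemma IsGenerativeSample.measureReal_exists_lt_shortfallError_le [Fintype A]
    (hX : IsGenerativeSample μ P₀ X) (hN : 0 < N) (hr : ∀ h s a, r h s a ∈ Set.Icc (0 : ℝ) 1)
    (ρ : ℝ) {K τ θ : ℝ} (hK : 0 < K) (hτ : 0 < τ) (hθ : 0 < θ) :
    μ.real {ω | ∃ h s a, ∃ k : ℕ, k * θ ≤ K ∧
        τ < shortfallError r ρ P₀ (sampleAt X ω) h s a (k * θ)} ≤
      2 * H * Fintype.card S * Fintype.card A * (1 + K / θ) *
        Real.exp (-(N * τ ^ 2 / K ^ 2)) := by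
  have hfloor : (⌊K / θ⌋₊ : ℝ) ≤ K / θ := Nat.floor_le (div_pos hK hθ).le
  let E (j : Fin H × S × A × Fin (⌊K / θ⌋₊ + 1)) : Set Ω :=
    {ω | τ < shortfallError r ρ P₀ (sampleAt X ω) j.1 j.2.1 j.2.2.1 ((j.2.2.2 : ℕ) * θ)}
  have hE (j) : μ.real (E j) ≤ 2 * Real.exp (-(N * τ ^ 2 / K ^ 2)) := by
    refine hX.measureReal_lt_shortfallError_le hN hr ρ ((le_div_iff₀ hθ).1 ?_) hK hτ _ _ _
    exact hfloor.trans' (Nat.cast_le.2 (Nat.lt_succ_iff.1 j.2.2.2.2))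
  have hcover : {ω | ∃ h s a, ∃ k : ℕ, k * θ ≤ K ∧
      τ < shortfallError r ρ P₀ (sampleAt X ω) h s a (k * θ)} ⊆ ⋃ j, E j := by
    rintro ω ⟨h, s, a, k, hk, hlt⟩
    exact Set.mem_iUnion.2
      ⟨(h, s, a, ⟨k, Nat.lt_succ_iff.2 (Nat.le_floor ((le_div_iff₀ hθ).2 hk))⟩), hlt⟩
  calc _ ≤ μ.real (⋃ j, E j) := measureReal_mono hcover
    _ ≤ ∑ j, μ.real (E j) := measureReal_iUnion_fintype_le _
    _ ≤ ∑ _ : Fin H × S × A × Fin (⌊K / θ⌋₊ + 1), 2 * Real.exp (-(N * τ ^ 2 / K ^ 2)) :=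
        Finset.sum_le_sum fun j _ => hE j
    _ = 2 * H * Fintype.card S * Fintype.card A * (1 + ⌊K / θ⌋₊) *
          Real.exp (-(N * τ ^ 2 / K ^ 2)) := by
        simp only [Finset.sum_const, Finset.card_univ, Fintype.card_prod, Fintype.card_fin,
          nsmul_eq_mul]
        push_cast
        ring
    _ ≤ _ := by gcongr

theorem IsGenerativeSample.one_sub_le_measureReal_forall_isRPVLOutput [Fintype A]
    (hX : IsGenerativeSample μ P₀ X) (hH : 0 < H) (hN : 0 < N)
    (hr : ∀ h s a, r h s a ∈ Set.Icc (0 : ℝ) 1) (hP₀ : ∀ h s a, P₀ h s a ∈ stdSimplex ℝ S)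
    {ρ K τ θ : ℝ} (hρ : 0 < ρ) (hK : K = √(1 + ρ) * H / (√(1 + ρ) - 1)) (hτ : 0 < τ)
    (hθ : 0 < θ) :
    1 - 2 * H * Fintype.card S * Fintype.card A * (1 + K / θ) *
        Real.exp (-(N * τ ^ 2 / K ^ 2)) ≤
      μ.real {ω | ∀ π : Fin H → S → A, IsRPVLOutput r ρ (sampleAt X ω) π →
        ∀ h s, |optRobustValue r ρ P₀ h s - robustValue r ρ P₀ π h s| ≤
          2 * H * (√(1 + ρ) * τ + θ)} := by
  have hK0 : 0 < K := by
    have hC : 1 < √(1 + ρ) := Real.lt_sqrt_of_sq_lt (by linarith)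
    rw [hK]
    exact div_pos (mul_pos (by linarith) (Nat.cast_pos.2 hH)) (sub_pos.2 hC)
  set bad := {ω | ∃ h s a, ∃ k : ℕ, k * θ ≤ K ∧
    τ < shortfallError r ρ P₀ (sampleAt X ω) h s a (k * θ)}
  have hbad : μ.real bad ≤ _ := hX.measureReal_exists_lt_shortfallError_le hN hr ρ hK0 hτ hθ
  calc _ ≤ 1 - μ.real bad := by gcongr
    _ ≤ μ.real badᶜ := by
        have hunion := measureReal_union_le (μ := μ) bad badᶜ
        rw [Set.union_compl_self, probReal_univ] at hunion
        linarith
    _ ≤ _ := by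
        refine measureReal_mono fun ω (hω : ω ∉ bad) π hπ => ?_
        exact hπ.abs_optRobustValue_sub_le hN hr hP₀ hρ hτ.le hθ fun h s a k hk =>
          not_lt.1 fun hlt => hω ⟨h, s, a, k, hK ▸ hk, hlt⟩

end RPVL

section SampleComplexity

lemma mul_exp_neg_le_of_log_div_le {y δ x : ℝ} (hy : 0 < y) (hδ : 0 < δ)
    (hlog : Real.log (y / δ) ≤ x) : y * Real.exp (-x) ≤ δ := by
  have hexp : y / δ ≤ Real.exp x := (Real.log_le_iff_le_exp (div_pos hy hδ)).1 hlog
  rw [Real.exp_neg, ← div_eq_mul_inv, div_le_iff₀ (Real.exp_pos x)]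
  exact (div_le_iff₀' hδ).1 hexp

lemma le_mul_sq_div_sq_of_le {H S A C ε L N : ℝ} (hH : 0 < H) (hS : 0 < S) (hA : 0 < A)
    (hC : 1 < C) (hε : 0 < ε)
    (hN : 16 * C ^ 4 * H ^ 5 * S * A / ((C - 1) ^ 2 * ε ^ 2) * L ≤ N * S * A * H) :
    L ≤ N * (ε / (4 * H * C)) ^ 2 / (C * H / (C - 1)) ^ 2 := by
  have hC1 : 0 < C - 1 := sub_pos.2 hC
  calc L = 16 * C ^ 4 * H ^ 5 * S * A / ((C - 1) ^ 2 * ε ^ 2) * L *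
          ((C - 1) ^ 2 * ε ^ 2 / (16 * C ^ 4 * H ^ 5 * S * A)) := by field_simp
    _ ≤ N * S * A * H * ((C - 1) ^ 2 * ε ^ 2 / (16 * C ^ 4 * H ^ 5 * S * A)) := by gcongr
    _ = _ := by
        field_simp
        norm_num

lemma one_lt_two_mul_card_mul {S A : Type*} [Fintype S] [Nonempty S] [Fintype A] [Nonempty A]
    {H : ℕ} (hH : 0 < H) {x : ℝ} (hx : 0 ≤ x) :
    1 < 2 * (H : ℝ) * Fintype.card S * Fintype.card A * (1 + x) := by
  have hcard : (1 : ℝ) ≤ H * Fintype.card S * Fintype.card A := by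
    exact_mod_cast Nat.succ_le_of_lt (by positivity : 0 < H * Fintype.card S * Fintype.card A)
  nlinarith

end SampleComplexity

end

end RobustMDP

theorem theorem2_general {S A Ω : Type*} [Fintype S] [Nonempty S] [DecidableEq S]
    [MeasurableSpace S] [MeasurableSingletonClass S] [Fintype A] [Nonempty A]
    [MeasurableSpace Ω] (μ : Measure Ω) [IsProbabilityMeasure μ]
    (H N : ℕ) (r : Fin H → S → A → ℝ) (hr : ∀ h s a, r h s a ∈ Set.Icc (0 : ℝ) 1)
    (P₀ : Fin H → S → A → S → ℝ) (hP₀ : ∀ h s a, P₀ h s a ∈ stdSimplex ℝ S)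
    (X : Fin H → S → A → Fin N → Ω → S) (hX : RobustMDP.IsGenerativeSample μ P₀ X)
    (δ ρ ε C : ℝ) (hδ : δ ∈ Set.Ioo (0 : ℝ) 1) (hρ : 0 < ρ) (hε : 0 < ε)
    (hC : C = Real.sqrt (1 + ρ))
    (hN : 16 * C ^ 4 * (H : ℝ) ^ 5 * (Fintype.card S : ℝ) * (Fintype.card A : ℝ) /
          ((C - 1) ^ 2 * ε ^ 2) *
        Real.log (2 * (H : ℝ) * (Fintype.card S : ℝ) * (Fintype.card A : ℝ) *
          (1 + 4 * C * (H : ℝ) ^ 2 / (ε * (C - 1))) / δ) ≤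
      (N : ℝ) * (Fintype.card S : ℝ) * (Fintype.card A : ℝ) * (H : ℝ)) :
    ENNReal.ofReal (1 - δ) ≤
      μ {ω | ∀ π : Fin H → S → A,
        RobustMDP.IsRPVLOutput r ρ (fun h s a i => X h s a i ω) π →
        ∀ h s, |RobustMDP.optRobustValue r ρ P₀ h s - RobustMDP.robustValue r ρ P₀ π h s| ≤ ε} := by
  rcases H.eq_zero_or_pos with rfl | hH
  · simp [hδ.1.le]
  have hH0 : (0 : ℝ) < H := Nat.cast_pos.2 hH
  have hC1 : 0 < C - 1 := sub_pos.2 (hC ▸ Real.lt_sqrt_of_sq_lt (by linarith))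
  have hC0 : 0 < C := by linarith
  have hcount : 1 < 2 * (H : ℝ) * Fintype.card S * Fintype.card A *
      (1 + 4 * C * (H : ℝ) ^ 2 / (ε * (C - 1))) :=
    RobustMDP.one_lt_two_mul_card_mul hH (by positivity)
  have hlog := RobustMDP.le_mul_sq_div_sq_of_le hH0 (by positivity) (by positivity)
    (sub_pos.1 hC1) hε hN
  have hN0 : 0 < N := by
    have hpos := (Real.log_pos ((one_lt_div hδ.1).2 (hδ.2.trans hcount))).trans_le hlog
    exact Nat.pos_of_ne_zero fun h => by simp [h] at hpos
  have hfail := RobustMDP.mul_exp_neg_le_of_log_div_le (one_pos.trans hcount) hδ.1 hlog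
  have hgrid : C * H / (C - 1) / (ε / (4 * H)) = 4 * C * (H : ℝ) ^ 2 / (ε * (C - 1)) := by
    field_simp
  have herror : 2 * H * (C * (ε / (4 * H * C)) + ε / (4 * H)) = ε := by
    field_simp
    norm_num
  have hprob := hX.one_sub_le_measureReal_forall_isRPVLOutput hH hN0 hr hP₀ hρ rfl
    (τ := ε / (4 * H * C)) (θ := ε / (4 * H)) (by positivity) (by positivity)
  rw [← hC, hgrid, herror] at hprob
  exact ENNReal.ofReal_le_of_le_toReal ((sub_le_sub_left hfail 1).trans hprob)

theorem theorem2 {S A Ω : Type*} [Fintype S] [Nonempty S] [DecidableEq S] [MeasurableSpace S]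
    [MeasurableSingletonClass S] [Fintype A] [Nonempty A]
    [MeasurableSpace Ω] (μ : Measure Ω) [IsProbabilityMeasure μ]
    (H N : ℕ) (r : Fin H → S → A → ℝ) (hr : ∀ h s a, r h s a ∈ Set.Icc (0 : ℝ) 1)
    (P₀ : Fin H → S → A → S → ℝ) (hP₀ : ∀ h s a, P₀ h s a ∈ stdSimplex ℝ S)
    (X : Fin H → S → A → Fin N → Ω → S) (hX : RobustMDP.IsGenerativeSample μ P₀ X)
    (δ ρ ε C : ℝ) (hδ : δ ∈ Set.Ioo (0 : ℝ) 1) (hρ : 0 < ρ)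
    (hε : ε ∈ Set.Ioo (0 : ℝ) (8 * (H : ℝ))) (hC : C = Real.sqrt (1 + ρ))
    (hN : 128 * C ^ 4 * (H : ℝ) ^ 5 * (Fintype.card S : ℝ) * (Fintype.card A : ℝ) /
          ((C - 1) ^ 2 * ε ^ 2) *
        Real.log (2 * (H : ℝ) * (Fintype.card S : ℝ) * (Fintype.card A : ℝ) *
          (1 + 8 * C * (H : ℝ) ^ 2 / (ε * (C - 1))) / δ) ≤
      (N : ℝ) * (Fintype.card S : ℝ) * (Fintype.card A : ℝ) * (H : ℝ)) :
    ENNReal.ofReal (1 - δ) ≤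
      μ {ω | ∀ π : Fin H → S → A,
        RobustMDP.IsRPVLOutput r ρ (fun h s a i => X h s a i ω) π →
        ∀ h s, |RobustMDP.optRobustValue r ρ P₀ h s - RobustMDP.robustValue r ρ P₀ π h s| ≤ ε} := by
  refine (theorem2_general μ H N r hr P₀ hP₀ X hX δ ρ (ε / 2) C hδ hρ (half_pos hε.1) hC ?_).trans
    (measure_mono fun ω hω π hπ h s => (hω π hπ h s).trans (half_le_self hε.1.le))
  generalize C - 1 = D at hN ⊢
  rw [show 4 * C * (H : ℝ) ^ 2 / (ε / 2 * D) = 8 * C * H ^ 2 / (ε * D) by ring]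
  refine le_trans (le_of_eq ?_)
    ((div_le_div_of_nonneg_right hN zero_le_two).trans (half_le_self (by positivity)))
  ring
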